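/- Let $\mathbb{T}\subseteq\mathbb{R}$ be a time scale (a nonempty closed set) that is unbounded above, with forward jump operator $\sigma(t)=\inf\{s\in\mathbb{T}: s>t\}$ and bounded graininess $\mu(t)=\sigma(t)-t$. For integers $n,m,p\ge 0$, a regressive linear system of dimension $n$ with $m$ inputs and $p$ outputs is $$x^{\Delta}(t)=A(t)x(t)+B(t)u(t),\qquad y(t)=C(t)x(t),\qquad t\in\mathbb{T},$$ where ${}^{\Delta}$ is the delta derivative, $A(t)\in\mathbb{R}^{n\times n}$, $B(t)\in\mathbb{R}^{n\times m}$, $C(t)\in\mathbb{R}^{p\times n}$ are rd-continuous on $\mathbb{T}$, and $I+\mu(t)A(t)$ is invertible for every $t\in\mathbb{T}$. Its transition matrix $\Phi_A(\cdot,\tau)$ is the solution of $X^{\Delta}=A(t)X$, $X(\tau)=I$, on $\mathbb{T}$. The system is a realization of the weighting pattern $G(t,\sigma(s))$, a $p\times m$ matrix given for each $(t,s)\in\mathbb{T}\times\mathbb{T}$, if $$G(t,\sigma(s))=C(t)\,\Phi_A(t,\sigma(s))\,B(s)\qquad\text{for all } t,s\in\mathbb{T},$$ and a realization of dimension $n$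 is minimal if no regressive linear system of dimension less than $n$, with the same $\mathbb{T},m,p$, is a realization of the same weighting pattern (dimension $0$ is allowed; it realizes exactly the zero pattern). For $t_0<t_f$ in $\mathbb{T}$, the system is controllable on $[t_0,t_f]$ if for all $x_0,x_f\in\mathbb{R}^n$ there is an rd-continuous input $u$ on $\mathbb{T}$ such that the solution with $x(t_0)=x_0$ satisfies $x(t_f)=x_f$; it is observable on $[t_0,t_f]$ if, for $u=0$, the initial state $x(t_0)$ is uniquely determined by the response $y(t)$ for $t\in\mathbb{T}$, $t_0\le t<t_f$. **Theorem (Characterization of Minimal Realizations).** Suppose that a regressive linear system is a realization of the weighting pattern $G(t,\sigma(s))$. Then this realization is minimal if and only if there are $t_0,t_f\in\mathbb{T}$ with $t_0<t_f$ such that the system is both controllable and observable on $[t_0,t_f]$. -/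

import Mathlib

open Set Filter Topology Matrix

/-- A time scale: a nonempty closed subset of the real line.

Functions on a time scale `T` are represented by functions on `ℝ`; every notion below
only looks at their values at points of `T`. -/
structure IsTimeScale (T : Set ℝ) : Prop where
  nonempty : T.Nonempty
  isClosed : IsClosed T

/-- The forward jump operator `σ(t) = inf {s ∈ T : s > t}`. -/
noncomputable def forwardJump (T : Set ℝ) (t : ℝ) : ℝ := sInf {s | s ∈ T ∧ t < s}

/-- The graininess `μ(t) = σ(t) - t`. -/
noncomputable def graininess (T : Set ℝ) (t : ℝ) : ℝ := forwardJump T t - t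

/-- `HasDeltaDeriv T f f' t`: the delta (Hilger) derivative of `f` at `t ∈ T` exists and equals
`f'`, that is, for every `ε > 0` there is a neighbourhood `U` of `t` such that
`‖f (σ t) - f s - (σ t - s) f'‖ ≤ ε |σ t - s|` for all `s ∈ U ∩ T`. -/
def HasDeltaDeriv {E : Type*} [NormedAddCommGroup E] [NormedSpace ℝ E]
    (T : Set ℝ) (f : ℝ → E) (f' : E) (t : ℝ) : Prop :=
  ∀ ε : ℝ, 0 < ε → ∀ᶠ s in 𝓝[T] t,
    ‖f (forwardJump T t) - f s - (forwardJump T t - s) • f'‖ ≤ ε * |forwardJump T t - s|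

/-- `f` is rd-continuous on `T`: it is continuous at the right-dense points of `T`, and has a
(finite) left-sided limit at the left-dense points of `T`. The second clause is automatic
at a point `t` that is not left-dense, because then the filter `𝓝[T ∩ Iio t] t` is trivial. -/
def RdContinuous {E : Type*} [TopologicalSpace E] (T : Set ℝ) (f : ℝ → E) : Prop :=
  ∀ t ∈ T, (forwardJump T t = t → ContinuousWithinAt f T t) ∧
    ∃ l : E, Tendsto f (𝓝[T ∩ Iio t] t) (𝓝 l)

/-- `Φ` is the transition matrix of `x^Δ = A(t) x` on `T`: for every `τ ∈ T`, the matrix function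
`t ↦ Φ t τ` solves `X^Δ(t) = A(t) X(t)` on all of `T` (entry by entry), with `X(τ) = I`. -/
def IsTransitionMatrix (T : Set ℝ) {n : ℕ} (A : ℝ → Matrix (Fin n) (Fin n) ℝ)
    (Φ : ℝ → ℝ → Matrix (Fin n) (Fin n) ℝ) : Prop :=
  ∀ τ ∈ T, Φ τ τ = 1 ∧
    ∀ t ∈ T, ∀ i j, HasDeltaDeriv T (fun r => Φ r τ i j) ((A t * Φ t τ) i j) t

/-- A regressive linear system `x^Δ = A(t) x + B(t) u`, `y = C(t) x` on `T` with rd-continuous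
coefficients, of (state) dimension `n`, with `m` inputs and `p` outputs. -/
structure RegressiveSystem (T : Set ℝ) (n m p : ℕ) where
  A : ℝ → Matrix (Fin n) (Fin n) ℝ
  B : ℝ → Matrix (Fin n) (Fin m) ℝ
  C : ℝ → Matrix (Fin p) (Fin n) ℝ
  rdContinuous_A : RdContinuous T A
  rdContinuous_B : RdContinuous T B
  rdContinuous_C : RdContinuous T C
  regressive : ∀ t ∈ T, IsUnit (1 + graininess T t • A t)

namespace RegressiveSystem

/-- `x` solves the state equation `x^Δ = A(t) x + B(t) u` on `T`. -/
def IsSolution {T : Set ℝ} {n m p : ℕ} (S : RegressiveSystem T n m p)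
    (u : ℝ → Fin m → ℝ) (x : ℝ → Fin n → ℝ) : Prop :=
  ∀ t ∈ T, HasDeltaDeriv T x (S.A t *ᵥ x t + S.B t *ᵥ u t) t

/-- Controllability on `[t₀, t_f]`: every initial state can be steered to every final state
by an rd-continuous input. -/
def IsControllable {T : Set ℝ} {n m p : ℕ} (S : RegressiveSystem T n m p) (t₀ tf : ℝ) : Prop :=
  ∀ x₀ xf : Fin n → ℝ, ∃ u : ℝ → Fin m → ℝ, RdContinuous T u ∧
    ∃ x : ℝ → Fin n → ℝ, S.IsSolution u x ∧ x t₀ = x₀ ∧ x tf = xf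

/-- Observability on `[t₀, t_f]`: the initial state `x(t₀)` is uniquely determined by the
zero-input response `y(t) = C(t) x(t)` for `t ∈ [t₀, t_f)`. -/
def IsObservable {T : Set ℝ} {n m p : ℕ} (S : RegressiveSystem T n m p) (t₀ tf : ℝ) : Prop :=
  ∀ x x' : ℝ → Fin n → ℝ, S.IsSolution 0 x → S.IsSolution 0 x' →
    (∀ t ∈ T, t₀ ≤ t → t < tf → S.C t *ᵥ x t = S.C t *ᵥ x' t) → x t₀ = x' t₀

/-- `S` is a realization of the weighting pattern `G`, where `G t s` is the value written
`G(t, σ(s))`: with `Φ` the transition matrix, `G(t, σ(s)) = C(t) Φ(t, σ(s)) B(s)`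
for all `t, s ∈ T`. -/
def IsRealization {T : Set ℝ} {n m p : ℕ} (S : RegressiveSystem T n m p)
    (G : ℝ → ℝ → Matrix (Fin p) (Fin m) ℝ) : Prop :=
  ∃ Φ : ℝ → ℝ → Matrix (Fin n) (Fin n) ℝ, IsTransitionMatrix T S.A Φ ∧
    ∀ t ∈ T, ∀ s ∈ T, G t s = S.C t * Φ t (forwardJump T s) * S.B s

/-- `S` is a minimal realization of `G`: a realization such that no realization of `G` has
smaller dimension. -/
def IsMinimalRealization {T : Set ℝ} {n m p : ℕ} (S : RegressiveSystem T n m p)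
    (G : ℝ → ℝ → Matrix (Fin p) (Fin m) ℝ) : Prop :=
  S.IsRealization G ∧
    ¬ ∃ k : ℕ, k < n ∧ ∃ S' : RegressiveSystem T k m p, S'.IsRealization G

end RegressiveSystem

/-! Fix `τ` in `T`. The substitution `x(t) = Φ(t, τ) z(t)` removes the drift: `z^Δ = β(t) u` and `y
= γ(t) z`, with `β(s) = Φ(τ, σ(s)) B(s)` (`transformedInput`) and `γ(t) = C(t) Φ(t, τ)`
(`transformedOutput`). The cocycle property of `Φ` separates the weighting pattern: `G(t, σ(s)) =
γ(t) β(s)`.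

By a Gramian argument, controllability on an interval means that no nonzero row vector annihilates
`β` there (`isControllable_iff`). Observability means that no nonzero vector is annihilated by `γ`
there (`isObservable_iff`). If both hold, the inner dimension of the factorization cannot be lowered
(`le_of_mul_eq_mul`), so the realization is minimal.

Conversely, a nonzero vector annihilating `β` or `γ` on all of `T` can be projected out. The smaller
factorization is realized by a system with `A = 0` and `Φ = 1`
(`exists_isRealization_of_factorization`), so no existence theorem for transition matrices is
needed. Minimality thus excludes such vectors on `T`, and finite dimension excludes them already on
one bounded interval (`exists_bounded_of_iInf_eq_bot`).

The analysis behind this is uniqueness in both time directions (`solution_eq_zero`), which gives the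
cocycle property, and a delta integral for rd-continuous functions. -/

/-! ### Forward jump and induction on time scales. -/

section Jump

variable {T : Set ℝ}

lemma exists_mem_gt (hu : ¬ BddAbove T) (t : ℝ) : ∃ s ∈ T, t < s := by
  by_contra! h
  exact hu ⟨t, fun s hs => h s hs⟩

lemma forwardJump_le {t s : ℝ} (hs : s ∈ T) (hts : t < s) : forwardJump T t ≤ s :=
  csInf_le ⟨t, fun _ hr => hr.2.le⟩ ⟨hs, hts⟩

lemma le_forwardJump (hu : ¬ BddAbove T) (t : ℝ) : t ≤ forwardJump T t :=
  le_csInf (exists_mem_gt hu t) fun _ hr => hr.2.le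

lemma forwardJump_mem (hT : IsTimeScale T) (hu : ¬ BddAbove T) (t : ℝ) :
    forwardJump T t ∈ T :=
  closure_minimal (fun _ hr => hr.1) hT.isClosed
    (csInf_mem_closure (s := {s | s ∈ T ∧ t < s}) (exists_mem_gt hu t) ⟨t, fun _ hr => hr.2.le⟩)

lemma exists_mem_Ioo_of_forwardJump_eq (hu : ¬ BddAbove T) {t b : ℝ} (h : forwardJump T t = t)
    (hb : t < b) : ∃ s ∈ T, t < s ∧ s < b := by
  have : sInf {s | s ∈ T ∧ t < s} < b := by
    change forwardJump T t < b
    rwa [h]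
  obtain ⟨s, hs, hsb⟩ := exists_lt_of_csInf_lt (exists_mem_gt hu t) this
  exact ⟨s, hs.1, hs.2, hsb⟩

/-- The induction principle of time scales, from `a` up to `b`. -/
theorem IsTimeScale.induction (hT : IsTimeScale T) (hu : ¬ BddAbove T) {P : ℝ → Prop} {a b : ℝ}
    (ha : a ∈ T) (hb : b ∈ T) (hab : a ≤ b) (h0 : P a)
    (hscat : ∀ t ∈ T, a ≤ t → t < b → t < forwardJump T t → forwardJump T t ≤ b → P t →
      P (forwardJump T t))
    (hdense : ∀ t ∈ T, a ≤ t → t < b → forwardJump T t = t → P t → ∀ᶠ s in 𝓝[T] t, t < s → P s)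
    (hleft : ∀ t ∈ T, a < t → t ≤ b → (𝓝[T ∩ Iio t] t).NeBot → (∀ s ∈ T, a ≤ s → s < t → P s) →
      P t) :
    ∀ t ∈ T, a ≤ t → t ≤ b → P t := by
  -- `S` holds the end points up to which `P` is known. Its supremum `c` belongs to `S`, and `c < b`
  -- would let `hscat` or `hdense` go past it.
  set S : Set ℝ := {t | t ∈ T ∧ a ≤ t ∧ t ≤ b ∧ ∀ s ∈ T, a ≤ s → s ≤ t → P s} with hS
  have haS : a ∈ S := ⟨ha, le_rfl, hab, fun s _ h1 h2 => le_antisymm h1 h2 ▸ h0⟩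
  have hbdd : BddAbove S := ⟨b, fun s hs => hs.2.2.1⟩
  set c := sSup S with hc
  have hac : a ≤ c := le_csSup hbdd haS
  have hcb : c ≤ b := csSup_le ⟨a, haS⟩ fun s hs => hs.2.2.1
  have hccl : c ∈ closure S := csSup_mem_closure ⟨a, haS⟩ hbdd
  have hcT : c ∈ T := closure_minimal (fun _ hr => hr.1) hT.isClosed hccl
  have hlt : ∀ s ∈ T, a ≤ s → s < c → P s := fun s hs h1 h2 => by
    obtain ⟨t, ht, hst⟩ := exists_lt_of_lt_csSup ⟨a, haS⟩ h2
    exact ht.2.2.2 s hs h1 hst.le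
  have hPc : P c := by
    by_cases hcS : c ∈ S
    · exact hcS.2.2.2 c hcT hac le_rfl
    -- If `c` is not attained, it is a limit of points of `S` strictly to its left, hence
    -- left-dense.
    · have hac' : a < c := lt_of_le_of_ne hac fun h => hcS (h ▸ haS)
      refine hleft c hcT hac' hcb ?_ hlt
      rw [← mem_closure_iff_nhdsWithin_neBot]
      refine closure_mono (fun s hs => ?_) hccl
      exact ⟨hs.1, lt_of_le_of_ne (le_csSup hbdd hs) fun h => hcS ((show s = c from h) ▸ hs)⟩
  have hcS : c ∈ S := ⟨hcT, hac, hcb, fun s hs h1 h2 => by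
    rcases h2.lt_or_eq with h | h
    · exact hlt s hs h1 h
    · exact h ▸ hPc⟩
  have hcb' : c = b := by
    by_contra hne
    have hcb' : c < b := lt_of_le_of_ne hcb hne
    rcases (le_forwardJump hu c).lt_or_eq with h | h
    · have h3 : forwardJump T c ≤ b := forwardJump_le hb hcb'
      have hP := hscat c hcT hac hcb' h h3 hPc
      refine absurd (le_csSup hbdd (a := forwardJump T c) ?_) (not_le.2 h)
      refine ⟨forwardJump_mem hT hu c, hac.trans h.le, h3, fun s hs h1 h2 => ?_⟩
      rcases le_or_gt s c with h4 | h4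
      · exact hcS.2.2.2 s hs h1 h4
      · exact le_antisymm h2 (forwardJump_le hs h4) ▸ hP
    · have := hdense c hcT hac hcb' h.symm hPc
      rw [eventually_nhdsWithin_iff, Metric.eventually_nhds_iff] at this
      obtain ⟨δ, hδ, H⟩ := this
      obtain ⟨s, hs, hcs, hs2⟩ := exists_mem_Ioo_of_forwardJump_eq hu h.symm
        (b := min b (c + δ)) (lt_min hcb' (by linarith))
      refine absurd (le_csSup hbdd (a := s) ?_) (not_le.2 hcs)
      refine ⟨hs, hac.trans hcs.le, (hs2.trans_le (min_le_left _ _)).le, fun r hr h1 h2 => ?_⟩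
      rcases le_or_gt r c with h4 | h4
      · exact hcS.2.2.2 r hr h1 h4
      · refine H ?_ hr h4
        have := hs2.trans_le (min_le_right b (c + δ))
        rw [Real.dist_eq, abs_lt]
        constructor <;> linarith
  exact fun t ht h1 h2 => hcS.2.2.2 t ht h1 (hcb' ▸ h2)

end Jump

/-! ### Calculus of delta derivatives. -/

section DeltaDeriv

variable {T : Set ℝ} {E : Type*} [NormedAddCommGroup E] [NormedSpace ℝ E]

lemma hasDeltaDeriv_iff_isLittleO {f : ℝ → E} {f' : E} {t : ℝ} :
    HasDeltaDeriv T f f' t ↔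
      (fun s => f (forwardJump T t) - f s - (forwardJump T t - s) • f') =o[𝓝[T] t]
        fun s => forwardJump T t - s := by
  rw [Asymptotics.isLittleO_iff]
  rfl

/-- The filter `𝓝[T] t` is not punctured, so the defining inequality holds at `s = t` for every `ε`.
-/
lemma HasDeltaDeriv.forwardJump_sub {f : ℝ → E} {f' : E} {t : ℝ} (h : HasDeltaDeriv T f f' t)
    (ht : t ∈ T) : f (forwardJump T t) - f t = (forwardJump T t - t) • f' := by
  rw [← sub_eq_zero, ← norm_le_zero_iff]
  have h1 : ∀ ε : ℝ, 0 < ε → ‖f (forwardJump T t) - f t - (forwardJump T t - t) • f'‖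
      ≤ ε * |forwardJump T t - t| := fun ε hε => (h ε hε).self_of_nhdsWithin ht
  have h2 : Tendsto (fun ε : ℝ => ε * |forwardJump T t - t|) (𝓝[>] 0) (𝓝 0) := by
    have : Tendsto (fun ε : ℝ => ε * |forwardJump T t - t|) (𝓝 0) (𝓝 (0 * |forwardJump T t - t|)) :=
      tendsto_id.mul_const _
    rw [zero_mul] at this
    exact this.mono_left nhdsWithin_le_nhds
  exact ge_of_tendsto h2 (eventually_mem_nhdsWithin.mono fun ε hε => h1 ε hε)

lemma HasDeltaDeriv.continuousWithinAt {f : ℝ → E} {f' : E} {t : ℝ} (h : HasDeltaDeriv T f f' t)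
    (ht : t ∈ T) : ContinuousWithinAt f T t := by
  have hlim : Tendsto (fun s : ℝ => forwardJump T t - s) (𝓝[T] t) (𝓝 (forwardJump T t - t)) :=
    (tendsto_id.const_sub _).mono_left nhdsWithin_le_nhds
  have h1 := ((hasDeltaDeriv_iff_isLittleO.1 h).trans_isBigO (hlim.isBigO_one ℝ))
  rw [Asymptotics.isLittleO_one_iff] at h1
  have h2 : Tendsto (fun s => f (forwardJump T t) - (forwardJump T t - s) • f'
      - (f (forwardJump T t) - f s - (forwardJump T t - s) • f')) (𝓝[T] t)
      (𝓝 (f (forwardJump T t) - (forwardJump T t - t) • f' - 0)) :=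
    ((hlim.smul_const f').const_sub _).sub h1
  have h3 : f (forwardJump T t) - (forwardJump T t - t) • f' - 0 = f t := by
    rw [← h.forwardJump_sub ht]; abel
  rw [h3] at h2
  exact h2.congr fun s => by abel

lemma hasDeltaDeriv_const (c : E) (t : ℝ) : HasDeltaDeriv T (fun _ => c) 0 t :=
  fun ε hε => Eventually.of_forall fun s => by simpa using by positivity

lemma HasDeltaDeriv.add {f g : ℝ → E} {f' g' : E} {t : ℝ} (hf : HasDeltaDeriv T f f' t)
    (hg : HasDeltaDeriv T g g' t) : HasDeltaDeriv T (fun s => f s + g s) (f' + g') t := by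
  rw [hasDeltaDeriv_iff_isLittleO] at *
  refine (hf.add hg).congr_left fun s => ?_
  rw [smul_add]; abel

lemma HasDeltaDeriv.sub {f g : ℝ → E} {f' g' : E} {t : ℝ} (hf : HasDeltaDeriv T f f' t)
    (hg : HasDeltaDeriv T g g' t) : HasDeltaDeriv T (fun s => f s - g s) (f' - g') t := by
  rw [hasDeltaDeriv_iff_isLittleO] at *
  refine (hf.sub hg).congr_left fun s => ?_
  rw [smul_sub]; abel

lemma HasDeltaDeriv.sum {ι : Type*} (I : Finset ι) {f : ι → ℝ → E} {f' : ι → E} {t : ℝ}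
    (h : ∀ i ∈ I, HasDeltaDeriv T (f i) (f' i) t) :
    HasDeltaDeriv T (fun s => ∑ i ∈ I, f i s) (∑ i ∈ I, f' i) t := by
  simp only [hasDeltaDeriv_iff_isLittleO] at *
  refine (Asymptotics.IsLittleO.sum h).congr_left fun s => ?_
  simp [Finset.sum_sub_distrib, Finset.smul_sum]

lemma hasDeltaDeriv_pi {ι : Type*} [Fintype ι] {f : ℝ → ι → ℝ} {f' : ι → ℝ} {t : ℝ} :
    HasDeltaDeriv T f f' t ↔ ∀ i, HasDeltaDeriv T (fun s => f s i) (f' i) t := by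
  simp only [hasDeltaDeriv_iff_isLittleO]
  rw [Asymptotics.isLittleO_pi]
  rfl

lemma HasDeltaDeriv.mul {f g : ℝ → ℝ} {f' g' : ℝ} {t : ℝ} (ht : t ∈ T)
    (hf : HasDeltaDeriv T f f' t) (hg : HasDeltaDeriv T g g' t) :
    HasDeltaDeriv T (fun s => f s * g s) (f' * g t + f (forwardJump T t) * g') t := by
  have hgc := hg.continuousWithinAt ht
  rw [hasDeltaDeriv_iff_isLittleO] at *
  have h1 := hg.const_mul_left (f (forwardJump T t))
  have h2 := (hf.mul_isBigO (hgc.isBigO_one ℝ))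
  have h3 : (fun s => (forwardJump T t - s) * (f' * (g s - g t))) =o[𝓝[T] t]
      fun s => (forwardJump T t - s) * 1 := by
    refine (Asymptotics.isBigO_refl _ _).mul_isLittleO ?_
    rw [Asymptotics.isLittleO_one_iff]
    have : Tendsto (fun s => f' * (g s - g t)) (𝓝[T] t) (𝓝 (f' * (g t - g t))) :=
      (hgc.sub_const _).const_mul _
    simpa using this
  simp only [mul_one] at h2 h3
  -- The remainder splits as `f(σ t)` times that of `g`, plus that of `f` times `g(s)`, plus `(σ t -
  -- s) f' (g(s) - g(t))`, which is small by continuity of `g`.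
  refine ((h1.add h2).add h3).congr_left fun s => ?_
  simp only [smul_eq_mul]
  ring

/-- The mean value inequality for delta derivatives. -/
theorem norm_sub_le_of_hasDeltaDeriv (hT : IsTimeScale T) (hu : ¬ BddAbove T) {f f' : ℝ → E}
    {M a b : ℝ} (ha : a ∈ T) (hb : b ∈ T) (hab : a ≤ b)
    (hf : ∀ t ∈ T, HasDeltaDeriv T f (f' t) t) (hM : ∀ t ∈ T, a ≤ t → t < b → ‖f' t‖ ≤ M) :
    ‖f b - f a‖ ≤ M * (b - a) := by
  -- The slack `ε` absorbs the error of the derivative at right-dense points.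
  have key : ∀ ε : ℝ, 0 < ε → ‖f b - f a‖ ≤ (M + ε) * (b - a) := fun ε hε => by
    refine hT.induction hu (P := fun t => ‖f t - f a‖ ≤ (M + ε) * (t - a)) ha hb hab (by simp)
      ?_ ?_ ?_ b hb hab le_rfl
    · intro t ht hat htb hlt _ hP
      have h1 : f (forwardJump T t) - f a = (f t - f a) + (forwardJump T t - t) • f' t := by
        rw [← (hf t ht).forwardJump_sub ht]; abel
      rw [h1]
      refine (norm_add_le _ _).trans ?_
      rw [norm_smul, Real.norm_of_nonneg (sub_nonneg.2 hlt.le)]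
      nlinarith [hM t ht hat htb, norm_nonneg (f' t)]
    · intro t ht hat htb heq hP
      filter_upwards [hf t ht ε hε] with s hs hts
      rw [heq, abs_sub_comm, abs_of_pos (sub_pos.2 hts)] at hs
      have h1 : f s - f a = (f t - f a) + (s - t) • f' t - (f t - f s - (t - s) • f' t) := by
        rw [← neg_sub s t, neg_smul]; abel
      rw [h1]
      refine (norm_sub_le _ _).trans ((add_le_add_left (norm_add_le _ _) _).trans ?_)
      rw [norm_smul, Real.norm_of_nonneg (sub_nonneg.2 hts.le)]
      nlinarith [hM t ht hat htb]
    · intro t ht hat htb hne hP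
      have hc : Tendsto f (𝓝[T ∩ Iio t] t) (𝓝 (f t)) :=
        ((hf t ht).continuousWithinAt ht).mono_left (nhdsWithin_mono _ inter_subset_left)
      have hr : Tendsto (fun s : ℝ => (M + ε) * (s - a)) (𝓝[T ∩ Iio t] t) (𝓝 ((M + ε) * (t - a))) :=
        ((tendsto_id.sub_const a).const_mul _).mono_left nhdsWithin_le_nhds
      refine le_of_tendsto_of_tendsto (hc.sub_const _).norm hr ?_
      have h2 : ∀ᶠ s in 𝓝[T ∩ Iio t] t, a < s :=
        (eventually_gt_nhds hat).filter_mono nhdsWithin_le_nhds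
      filter_upwards [h2, eventually_mem_nhdsWithin] with s h3 h4
      exact hP s h4.1 h3.le h4.2
  have h2 : Tendsto (fun ε : ℝ => (M + ε) * (b - a)) (𝓝[>] 0) (𝓝 (M * (b - a))) := by
    have : Tendsto (fun ε : ℝ => (M + ε) * (b - a)) (𝓝 0) (𝓝 ((M + 0) * (b - a))) :=
      (tendsto_id.const_add _).mul_const _
    rw [add_zero] at this
    exact this.mono_left nhdsWithin_le_nhds
  exact ge_of_tendsto h2 (eventually_mem_nhdsWithin.mono fun ε hε => key ε hε)

end DeltaDeriv

/-! ### Rd-continuous functions. -/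

section RdContinuous

variable {T : Set ℝ}

lemma RdContinuous.comp₂ {E F H : Type*} [TopologicalSpace E] [TopologicalSpace F]
    [TopologicalSpace H] {f : ℝ → E} {g : ℝ → F} (hf : RdContinuous T f) (hg : RdContinuous T g)
    {h : E → F → H} (hh : Continuous fun q : E × F => h q.1 q.2) :
    RdContinuous T fun t => h (f t) (g t) := by
  intro t ht
  obtain ⟨hf1, l, hl⟩ := hf t ht
  obtain ⟨hg1, k, hk⟩ := hg t ht
  exact ⟨fun hd => (hh.tendsto (f t, g t)).comp ((hf1 hd).prodMk_nhds (hg1 hd)),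
    h l k, (hh.tendsto (l, k)).comp (hl.prodMk_nhds hk)⟩

lemma RdContinuous.comp {E H : Type*} [TopologicalSpace E]
    [TopologicalSpace H] {f : ℝ → E} (hf : RdContinuous T f) {h : E → H} (hh : Continuous h) :
    RdContinuous T fun t => h (f t) :=
  hf.comp₂ hf (h := fun a _ => h a) (hh.comp continuous_fst)

lemma rdContinuous_of_continuousOn {E : Type*} [TopologicalSpace E] {f : ℝ → E}
    (hf : ContinuousOn f T) : RdContinuous T f := fun t ht =>
  ⟨fun _ => hf t ht, f t, (hf t ht).mono_left (nhdsWithin_mono _ inter_subset_left)⟩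

lemma tendsto_forwardJump_of_dense (hT : IsTimeScale T) (hu : ¬ BddAbove T) {t : ℝ}
    (hd : forwardJump T t = t) : Tendsto (forwardJump T) (𝓝[T] t) (𝓝[T] t) := by
  refine tendsto_nhdsWithin_iff.2 ⟨?_, Eventually.of_forall fun s => forwardJump_mem hT hu s⟩
  rw [tendsto_order]
  refine ⟨fun a ha => ?_, fun b hb => ?_⟩
  · filter_upwards [(eventually_gt_nhds ha).filter_mono nhdsWithin_le_nhds] with s hs
    exact hs.trans_le (le_forwardJump hu s)
  · obtain ⟨r, hr, htr, hrb⟩ := exists_mem_Ioo_of_forwardJump_eq hu hd hb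
    filter_upwards [(eventually_lt_nhds htr).filter_mono nhdsWithin_le_nhds] with s hs
    exact (forwardJump_le hr hs).trans_lt hrb

lemma tendsto_forwardJump_left (hT : IsTimeScale T) (hu : ¬ BddAbove T) {t : ℝ} (ht : t ∈ T) :
    Tendsto (forwardJump T) (𝓝[T ∩ Iio t] t) (𝓝[T] t) := by
  refine tendsto_nhdsWithin_iff.2 ⟨?_, Eventually.of_forall fun s => forwardJump_mem hT hu s⟩
  refine tendsto_of_tendsto_of_tendsto_of_le_of_le' (g := fun s => s) (h := fun _ => t)
    (tendsto_id.mono_left nhdsWithin_le_nhds) tendsto_const_nhds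
    (Eventually.of_forall fun s => le_forwardJump hu s) ?_
  filter_upwards [eventually_mem_nhdsWithin] with s hs
  exact forwardJump_le ht hs.2

/-- The left limit at `t` is `f t`, since `s ≤ σ(s) ≤ t`. It may differ from `f (σ t)`, so only
rd-continuity survives. -/
lemma ContinuousOn.rdContinuous_comp_forwardJump {E : Type*} [TopologicalSpace E]
    (hT : IsTimeScale T) (hu : ¬ BddAbove T) {f : ℝ → E} (hf : ContinuousOn f T) :
    RdContinuous T fun t => f (forwardJump T t) := by
  intro t ht
  refine ⟨fun hd => ?_, f t, (hf t ht).tendsto.comp (tendsto_forwardJump_left hT hu ht)⟩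
  have := (hf t ht).tendsto.comp (tendsto_forwardJump_of_dense hT hu hd)
  rw [ContinuousWithinAt, hd]
  exact this

lemma eventually_le_of_lt_forwardJump {t : ℝ} (hd : t < forwardJump T t) :
    ∀ᶠ s in 𝓝[T] t, s ≤ t := by
  filter_upwards [(eventually_lt_nhds hd).filter_mono nhdsWithin_le_nhds,
    eventually_mem_nhdsWithin] with s hs hsT
  by_contra! h
  exact absurd (forwardJump_le hsT h) (not_le.2 hs)

/-- An rd-continuous function is locally bounded. -/
lemma RdContinuous.exists_eventually_norm_le {E : Type*} [NormedAddCommGroup E]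
    (hu : ¬ BddAbove T) {f : ℝ → E} (hf : RdContinuous T f) {t : ℝ} (ht : t ∈ T) :
    ∃ K : ℝ, ∀ᶠ s in 𝓝[T] t, ‖f s‖ ≤ K := by
  obtain ⟨h1, l, hl⟩ := hf t ht
  rcases (le_forwardJump hu t).eq_or_lt with hd | hd
  · exact ⟨‖f t‖ + 1, ((h1 hd.symm).norm.eventually (gt_mem_nhds (lt_add_one _))).mono
      fun _ h => h.le⟩
  · have hl2 := hl.norm.eventually (gt_mem_nhds (lt_add_one _))
    rw [eventually_nhdsWithin_iff] at hl2
    refine ⟨max (‖l‖ + 1) ‖f t‖, ?_⟩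
    filter_upwards [hl2.filter_mono nhdsWithin_le_nhds, eventually_le_of_lt_forwardJump hd,
      eventually_mem_nhdsWithin] with s h2 h3 h4
    rcases h3.lt_or_eq with h5 | h5
    · exact le_max_of_le_left (h2 ⟨h4, h5⟩).le
    · exact h5 ▸ le_max_right _ _

lemma RdContinuous.exists_norm_le {E : Type*} [NormedAddCommGroup E] (hT : IsTimeScale T)
    (hu : ¬ BddAbove T) {f : ℝ → E} (hf : RdContinuous T f) (a b : ℝ) :
    ∃ K : ℝ, 0 ≤ K ∧ ∀ t ∈ T, a ≤ t → t ≤ b → ‖f t‖ ≤ K := by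
  have hc : IsCompact (T ∩ Icc a b) := isCompact_Icc.inter_left hT.isClosed
  obtain ⟨K, hK⟩ : ∃ K : ℝ, ∀ t ∈ T ∩ Icc a b, ‖f t‖ ≤ K := by
    refine hc.induction_on (p := fun s => ∃ K : ℝ, ∀ t ∈ s, ‖f t‖ ≤ K) ⟨0, by simp⟩
      (fun s t hst ⟨K, h⟩ => ⟨K, fun r hr => h r (hst hr)⟩) ?_ ?_
    · rintro s t ⟨K, hK⟩ ⟨L, hL⟩
      exact ⟨max K L, fun r hr => hr.elim (fun h => le_max_of_le_left (hK r h))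
        fun h => le_max_of_le_right (hL r h)⟩
    · intro t ht
      obtain ⟨K, hK⟩ := hf.exists_eventually_norm_le hu ht.1
      exact ⟨_, nhdsWithin_mono _ inter_subset_left hK, K, fun _ h => h⟩
  exact ⟨max K 0, le_max_right _ _, fun t ht h1 h2 => le_max_of_le_left (hK t ⟨ht, h1, h2⟩)⟩

end RdContinuous

/-- The entry sum is a continuous function of the matrix, so local bounds for `A` follow without a
norm on matrices. -/
lemma norm_mulVec_le_sum_abs {m n : ℕ} (A : Matrix (Fin m) (Fin n) ℝ) (v : Fin n → ℝ) :
    ‖A *ᵥ v‖ ≤ (∑ i, ∑ j, |A i j|) * ‖v‖ := by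
  have h0 : 0 ≤ ∑ i, ∑ j, |A i j| :=
    Finset.sum_nonneg fun i _ => Finset.sum_nonneg fun j _ => abs_nonneg _
  refine (pi_norm_le_iff_of_nonneg (mul_nonneg h0 (norm_nonneg _))).2 fun i => ?_
  calc ‖(A *ᵥ v) i‖ ≤ ∑ j, ‖A i j * v j‖ := norm_sum_le Finset.univ fun j => A i j * v j
    _ ≤ ∑ j, |A i j| * ‖v‖ := Finset.sum_le_sum fun j _ => by
        rw [norm_mul]
        exact mul_le_mul_of_nonneg_left (norm_le_pi_norm v j) (norm_nonneg _)
    _ = (∑ j, |A i j|) * ‖v‖ := (Finset.sum_mul _ _ _).symm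
    _ ≤ _ := by
        refine mul_le_mul_of_nonneg_right ?_ (norm_nonneg _)
        exact Finset.single_le_sum (f := fun i => ∑ j, |A i j|)
          (fun i _ => Finset.sum_nonneg fun j _ => abs_nonneg _) (Finset.mem_univ i)

/-! ### Uniqueness for homogeneous linear equations. -/

section Uniqueness

variable {T : Set ℝ} {n : ℕ} {A : ℝ → Matrix (Fin n) (Fin n) ℝ} {x : ℝ → Fin n → ℝ}

lemma RdContinuous.exists_norm_mulVec_le (hT : IsTimeScale T) (hu : ¬ BddAbove T)
    (hA : RdContinuous T A) (a b : ℝ) :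
    ∃ K : ℝ, 0 ≤ K ∧ ∀ t ∈ T, a ≤ t → t ≤ b → ∀ v, ‖A t *ᵥ v‖ ≤ K * ‖v‖ := by
  have hr : RdContinuous T fun t => ∑ i, ∑ j, |A t i j| :=
    hA.comp (h := fun M => ∑ i, ∑ j, |M i j|) (by fun_prop)
  obtain ⟨K, h0, hK⟩ := hr.exists_norm_le hT hu a b
  exact ⟨K, h0, fun t ht h1 h2 v => (norm_mulVec_le_sum_abs _ _).trans
    (mul_le_mul_of_nonneg_right ((le_abs_self _).trans (hK t ht h1 h2)) (norm_nonneg _))⟩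

/-- A solution of `x^Δ = A x` that vanishes somewhere on a short interval vanishes on all of it. -/
lemma eq_zero_of_short_interval (hT : IsTimeScale T) (hu : ¬ BddAbove T)
    (hx : ∀ t ∈ T, HasDeltaDeriv T x (A t *ᵥ x t) t) {a b c K : ℝ} (h0 : 0 ≤ K)
    (hK : ∀ t ∈ T, a ≤ t → t ≤ b → ∀ v, ‖A t *ᵥ v‖ ≤ K * ‖v‖) (hshort : K * (b - a) ≤ 1 / 2)
    (hc : c ∈ T) (hac : a ≤ c) (hcb : c ≤ b) (hxc : x c = 0) :
    ∀ t ∈ T, a ≤ t → t ≤ b → x t = 0 := by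
  have hcomp : IsCompact (T ∩ Icc a b) := isCompact_Icc.inter_left hT.isClosed
  have hcont : ContinuousOn (fun t => ‖x t‖) (T ∩ Icc a b) := fun t ht =>
    (((hx t ht.1).continuousWithinAt ht.1).mono inter_subset_left).norm
  -- At a maximum point `r` of `‖x‖`, the mean value inequality between `c` and `r` gives `‖x r‖ ≤
  -- ‖x r‖ / 2`.
  obtain ⟨r, ⟨hr, har, hrb⟩, hmax⟩ := hcomp.exists_isMaxOn ⟨c, hc, hac, hcb⟩ hcont
  have hbd : ∀ t ∈ T, a ≤ t → t ≤ b → ‖A t *ᵥ x t‖ ≤ K * ‖x r‖ := fun t ht h1 h2 =>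
    (hK t ht h1 h2 _).trans (mul_le_mul_of_nonneg_left (hmax ⟨ht, h1, h2⟩) h0)
  have hle : ‖x r‖ ≤ K * ‖x r‖ * (b - a) := by
    have hnn : 0 ≤ K * ‖x r‖ := mul_nonneg h0 (norm_nonneg _)
    rcases le_total c r with h | h
    · have := norm_sub_le_of_hasDeltaDeriv hT hu hc hr h hx
        fun t ht h1 h2 => hbd t ht (hac.trans h1) (h2.le.trans hrb)
      rw [hxc, sub_zero] at this
      exact this.trans (mul_le_mul_of_nonneg_left (by linarith) hnn)
    · have := norm_sub_le_of_hasDeltaDeriv hT hu hr hc h hx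
        fun t ht h1 h2 => hbd t ht (har.trans h1) (h2.le.trans hcb)
      rw [hxc, zero_sub, norm_neg] at this
      exact this.trans (mul_le_mul_of_nonneg_left (by linarith) hnn)
  have hxr : ‖x r‖ = 0 := by nlinarith [norm_nonneg (x r)]
  intro t ht h1 h2
  have : ‖x t‖ ≤ ‖x r‖ := hmax ⟨ht, h1, h2⟩
  exact norm_le_zero_iff.1 (this.trans hxr.le)

lemma eq_zero_of_le (hT : IsTimeScale T) (hu : ¬ BddAbove T) (hA : RdContinuous T A)
    (hx : ∀ t ∈ T, HasDeltaDeriv T x (A t *ᵥ x t) t) {a b : ℝ} (ha : a ∈ T) (hb : b ∈ T)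
    (hab : a ≤ b) (hxa : x a = 0) : x b = 0 := by
  obtain ⟨K, h0, hK⟩ := hA.exists_norm_mulVec_le hT hu a b
  refine hT.induction hu (P := fun t => x t = 0) ha hb hab hxa ?_ ?_ ?_ b hb hab le_rfl
  · intro t ht _ _ _ _ hP
    have := (hx t ht).forwardJump_sub ht
    rwa [hP, mulVec_zero, smul_zero, sub_zero] at this
  · intro t ht hat htb _ hP
    -- A length `δ` with `K δ ≤ 1 / 2`; the `+ 1` covers `K = 0`.
    have hδ : 0 < 1 / (2 * (K + 1)) := by positivity
    filter_upwards [(eventually_lt_nhds (lt_add_of_pos_right t hδ)).filter_mono nhdsWithin_le_nhds,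
      (eventually_lt_nhds htb).filter_mono nhdsWithin_le_nhds, eventually_mem_nhdsWithin]
      with s h1 h2 hs hts
    refine eq_zero_of_short_interval hT hu hx (a := t) (b := s) h0
      (fun r hr h3 h4 => hK r hr (hat.trans h3) (h4.trans h2.le)) ?_ ht le_rfl hts.le hP s hs
      hts.le le_rfl
    calc K * (s - t) ≤ (K + 1) * (1 / (2 * (K + 1))) :=
          mul_le_mul (by linarith) (by linarith) (by linarith) (by linarith)
      _ = 1 / 2 := by field_simp
  · intro t ht hat htb hne hP
    have hc : Tendsto x (𝓝[T ∩ Iio t] t) (𝓝 (x t)) :=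
      ((hx t ht).continuousWithinAt ht).mono_left (nhdsWithin_mono _ inter_subset_left)
    refine tendsto_nhds_unique hc (tendsto_const_nhds.congr' ?_)
    filter_upwards [(eventually_gt_nhds hat).filter_mono nhdsWithin_le_nhds,
      eventually_mem_nhdsWithin] with s h1 h2
    exact (hP s h2.1 h1.le h2.2).symm

/-- Backward uniqueness in contrapositive form, because the induction runs only upwards.
Regressivity enters at right-scattered points, where `x (σ t) = (1 + μ A) x t`. -/
lemma ne_zero_of_le (hT : IsTimeScale T) (hu : ¬ BddAbove T) (hA : RdContinuous T A)
    (hreg : ∀ t ∈ T, IsUnit (1 + graininess T t • A t))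
    (hx : ∀ t ∈ T, HasDeltaDeriv T x (A t *ᵥ x t) t) {a b : ℝ} (ha : a ∈ T) (hb : b ∈ T)
    (hab : a ≤ b) (hxa : x a ≠ 0) : x b ≠ 0 := by
  obtain ⟨K, h0, hK⟩ := hA.exists_norm_mulVec_le hT hu a b
  refine hT.induction hu (P := fun t => x t ≠ 0) ha hb hab hxa ?_ ?_ ?_ b hb hab le_rfl
  · intro t ht _ _ _ _ hP hzero
    have h1 := (hx t ht).forwardJump_sub ht
    refine hP (mulVec_injective_of_isUnit (hreg t ht) ?_)
    simp only [mulVec_zero, add_mulVec, one_mulVec, smul_mulVec, graininess]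
    rw [← h1, hzero]
    abel
  · intro t ht _ _ _ hP
    exact (((hx t ht).continuousWithinAt ht).eventually (isOpen_ne.mem_nhds hP)).mono
      fun s h _ => h
  · intro t ht hat htb hne hP hzero
    have hδ : 0 < 1 / (2 * (K + 1)) := by positivity
    have hev : ∀ᶠ s in 𝓝[T ∩ Iio t] t, t - 1 / (2 * (K + 1)) < s ∧ a < s ∧ s ∈ T ∩ Iio t :=
      ((eventually_gt_nhds (sub_lt_self t hδ)).filter_mono nhdsWithin_le_nhds).and
        (((eventually_gt_nhds hat).filter_mono nhdsWithin_le_nhds).and eventually_mem_nhdsWithin)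
    obtain ⟨s, h1, h2, hs, hst⟩ := hev.exists
    have hst : s < t := hst
    refine hP s hs h2.le hst ?_
    refine eq_zero_of_short_interval hT hu hx (a := s) (b := t) h0
      (fun r hr h3 h4 => hK r hr (h2.le.trans h3) (h4.trans htb)) ?_ ht hst.le le_rfl hzero s hs
      le_rfl hst.le
    calc K * (t - s) ≤ (K + 1) * (1 / (2 * (K + 1))) :=
          mul_le_mul (by linarith) (by linarith) (by linarith) (by linarith)
      _ = 1 / 2 := by field_simp

/-- Solutions of a regressive homogeneous linear equation are determined by one value. -/
theorem solution_eq_zero (hT : IsTimeScale T) (hu : ¬ BddAbove T) (hA : RdContinuous T A)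
    (hreg : ∀ t ∈ T, IsUnit (1 + graininess T t • A t))
    (hx : ∀ t ∈ T, HasDeltaDeriv T x (A t *ᵥ x t) t) {τ : ℝ} (hτ : τ ∈ T) (hxτ : x τ = 0) :
    ∀ t ∈ T, x t = 0 := by
  intro t ht
  rcases le_total τ t with h | h
  · exact eq_zero_of_le hT hu hA hx hτ ht h hxτ
  · by_contra hne
    exact ne_zero_of_le hT hu hA hreg hx ht hτ h hne hxτ

end Uniqueness

/-! ### Transition matrices. -/

section TransitionMatrix

variable {T : Set ℝ} {n : ℕ} {A : ℝ → Matrix (Fin n) (Fin n) ℝ}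
  {Φ : ℝ → ℝ → Matrix (Fin n) (Fin n) ℝ}

/-- Variation of constants: `Φ(t, τ) z(t)` solves the equation with inhomogeneity
`Φ(σ(t), τ) z^Δ(t)`. -/
lemma IsTransitionMatrix.hasDeltaDeriv_mulVec (hΦ : IsTransitionMatrix T A Φ) {τ t : ℝ}
    (hτ : τ ∈ T) (ht : t ∈ T) {z : ℝ → Fin n → ℝ} {z' : Fin n → ℝ} (hz : HasDeltaDeriv T z z' t) :
    HasDeltaDeriv T (fun s => Φ s τ *ᵥ z s)
      (A t *ᵥ (Φ t τ *ᵥ z t) + Φ (forwardJump T t) τ *ᵥ z') t := by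
  rw [hasDeltaDeriv_pi] at hz ⊢
  intro i
  have := HasDeltaDeriv.sum Finset.univ (t := t) fun j _ =>
    ((hΦ τ hτ).2 t ht i j).mul ht (hz j)
  rw [Finset.sum_add_distrib] at this
  rw [mulVec_mulVec]
  exact this

lemma IsTransitionMatrix.hasDeltaDeriv_mulVec_const (hΦ : IsTransitionMatrix T A Φ) {τ t : ℝ}
    (hτ : τ ∈ T) (ht : t ∈ T) (v : Fin n → ℝ) :
    HasDeltaDeriv T (fun s => Φ s τ *ᵥ v) (A t *ᵥ (Φ t τ *ᵥ v)) t := by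
  have := hΦ.hasDeltaDeriv_mulVec hτ ht (hasDeltaDeriv_const v t)
  rwa [mulVec_zero, add_zero] at this

/-- As functions of `t`, corresponding columns of both sides solve the same equation and agree at `t
= τ`. -/
lemma IsTransitionMatrix.mul (hT : IsTimeScale T) (hu : ¬ BddAbove T) (hA : RdContinuous T A)
    (hreg : ∀ t ∈ T, IsUnit (1 + graininess T t • A t)) (hΦ : IsTransitionMatrix T A Φ)
    {t τ s : ℝ} (ht : t ∈ T) (hτ : τ ∈ T) (hs : s ∈ T) : Φ t τ * Φ τ s = Φ t s := by
  refine ext_of_mulVec_single fun j => ?_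
  have hx : ∀ r ∈ T, HasDeltaDeriv T
      (fun r => Φ r τ *ᵥ (Φ τ s *ᵥ Pi.single j 1) - Φ r s *ᵥ Pi.single j 1)
      (A r *ᵥ (Φ r τ *ᵥ (Φ τ s *ᵥ Pi.single j 1) - Φ r s *ᵥ Pi.single j 1)) r := fun r hr => by
    rw [mulVec_sub]
    exact (hΦ.hasDeltaDeriv_mulVec_const hτ hr _).sub (hΦ.hasDeltaDeriv_mulVec_const hs hr _)
  have := solution_eq_zero hT hu hA hreg hx hτ (by rw [(hΦ τ hτ).1, one_mulVec, sub_self]) t ht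
  rw [← mulVec_mulVec]
  exact sub_eq_zero.1 this

lemma IsTransitionMatrix.continuousOn_left (hΦ : IsTransitionMatrix T A Φ) {τ : ℝ} (hτ : τ ∈ T) :
    ContinuousOn (fun t => Φ t τ) T := fun t ht =>
  continuousWithinAt_pi.2 fun i => continuousWithinAt_pi.2 fun j =>
    ((hΦ τ hτ).2 t ht i j).continuousWithinAt ht

/-- `Φ(τ, t)` is the inverse of `Φ(t, τ)`, and the adjugate formula makes the inverse continuous. -/
lemma IsTransitionMatrix.continuousOn_right (hT : IsTimeScale T) (hu : ¬ BddAbove T)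
    (hA : RdContinuous T A) (hreg : ∀ t ∈ T, IsUnit (1 + graininess T t • A t))
    (hΦ : IsTransitionMatrix T A Φ) {τ : ℝ} (hτ : τ ∈ T) : ContinuousOn (fun t => Φ τ t) T := by
  have hinv : ∀ t ∈ T, Φ t τ * Φ τ t = 1 := fun t ht => by
    rw [hΦ.mul hT hu hA hreg ht hτ ht, (hΦ t ht).1]
  have hdet : ∀ t ∈ T, (Φ t τ).det ≠ 0 := fun t ht h => by
    have := congrArg Matrix.det (hinv t ht)
    rw [det_mul, h, zero_mul, det_one] at this
    exact zero_ne_one this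
  have hc : ContinuousOn (fun t => ((Φ t τ).det)⁻¹ • (Φ t τ).adjugate) T := by
    have h := hΦ.continuousOn_left hτ
    refine ContinuousOn.smul (ContinuousOn.inv₀ ?_ hdet) ?_
    · exact (continuous_id.matrix_det).comp_continuousOn h
    · exact (continuous_id.matrix_adjugate).comp_continuousOn h
  refine hc.congr fun t ht => ?_
  rw [← inv_eq_right_inv (hinv t ht), inv_def, Ring.inverse_eq_inv']

end TransitionMatrix

/-! ### Extension from the time scale to the line. -/

section LastPoint

variable {T : Set ℝ}

/-- The last point of the time scale that is not after `r`. -/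
noncomputable def lastPoint (T : Set ℝ) (r : ℝ) : ℝ := sSup (T ∩ Iic r)

lemma lastPoint_of_mem {t : ℝ} (ht : t ∈ T) : lastPoint T t = t :=
  (show IsGreatest (T ∩ Iic t) t from ⟨⟨ht, le_refl t⟩, fun _ h => h.2⟩).csSup_eq

lemma lastPoint_le {s r : ℝ} (hs : s ∈ T) (hsr : s ≤ r) : lastPoint T r ≤ r :=
  csSup_le ⟨s, hs, hsr⟩ fun _ h => h.2

lemma le_lastPoint {s r : ℝ} (hs : s ∈ T) (hsr : s ≤ r) : s ≤ lastPoint T r :=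
  le_csSup ⟨r, fun _ h => h.2⟩ ⟨hs, hsr⟩

lemma lastPoint_mem (hT : IsTimeScale T) {s r : ℝ} (hs : s ∈ T) (hsr : s ≤ r) :
    lastPoint T r ∈ T :=
  closure_minimal inter_subset_left hT.isClosed
    (csSup_mem_closure (s := T ∩ Iic r) ⟨s, hs, hsr⟩ ⟨r, fun _ h => h.2⟩)

lemma lastPoint_eq_of_Ioc {q r : ℝ} (hqr : q ≤ r) (h : ∀ s ∈ T, s ≤ r → s ≤ q) :
    lastPoint T r = lastPoint T q := by
  have : T ∩ Iic r = T ∩ Iic q := by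
    ext s
    exact ⟨fun hs => ⟨hs.1, h s hs.1 hs.2⟩, fun hs => ⟨hs.1, le_trans hs.2 hqr⟩⟩
  rw [lastPoint, this, lastPoint]

lemma lastPoint_eq_of_lt_forwardJump {t r : ℝ} (ht : t ∈ T) (htr : t ≤ r)
    (hr : r < forwardJump T t) : lastPoint T r = t := by
  rw [lastPoint_eq_of_Ioc htr, lastPoint_of_mem ht]
  intro s hs hsr
  by_contra! h
  exact absurd (forwardJump_le hs h) (not_le.2 (hsr.trans_lt hr))

/-- Off `T` and at right-scattered points the extension is constant just to the right. This includes
points below `T`, where `lastPoint` has the default value `sSup ∅ = 0`. At right-dense points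
`lastPoint T q` is squeezed between `r` and `q`. -/
lemma RdContinuous.continuousWithinAt_comp_lastPoint {E : Type*} [TopologicalSpace E]
    (hT : IsTimeScale T) (hu : ¬ BddAbove T) {f : ℝ → E} (hf : RdContinuous T f) (r : ℝ) :
    ContinuousWithinAt (fun q => f (lastPoint T q)) (Ici r) r := by
  have hconst : ∀ b, r < b → (∀ q, r ≤ q → q < b → lastPoint T q = lastPoint T r) →
      ContinuousWithinAt (fun q => f (lastPoint T q)) (Ici r) r := fun b hb h => by
    refine tendsto_const_nhds.congr' ?_
    filter_upwards [(eventually_lt_nhds hb).filter_mono nhdsWithin_le_nhds,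
      eventually_mem_nhdsWithin] with q h1 h2
    rw [h q h2 h1]
  by_cases hr : r ∈ T
  · rcases (le_forwardJump hu r).eq_or_lt with hd | hd
    · have h1 := (hf r hr).1 hd.symm
      have h2 : Tendsto (lastPoint T) (𝓝[Ici r] r) (𝓝[T] r) := by
        refine tendsto_nhdsWithin_iff.2 ⟨?_, ?_⟩
        · refine tendsto_of_tendsto_of_tendsto_of_le_of_le' (g := fun _ => r) (h := fun q => q)
            tendsto_const_nhds (tendsto_id.mono_left nhdsWithin_le_nhds) ?_ ?_
          · filter_upwards [eventually_mem_nhdsWithin] with q hq using le_lastPoint hr hq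
          · filter_upwards [eventually_mem_nhdsWithin] with q hq using lastPoint_le hr hq
        · filter_upwards [eventually_mem_nhdsWithin] with q hq using lastPoint_mem hT hr hq
      rw [ContinuousWithinAt, lastPoint_of_mem hr]
      exact h1.tendsto.comp h2
    · exact hconst _ hd fun q h1 h2 => by
        rw [lastPoint_eq_of_lt_forwardJump hr h1 h2, lastPoint_of_mem hr]
  · obtain ⟨ε, hε, hball⟩ := Metric.isOpen_iff.1 hT.isClosed.isOpen_compl r hr
    refine hconst (r + ε) (by linarith) fun q h1 h2 => lastPoint_eq_of_Ioc h1 fun s hs hsq => ?_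
    by_contra! h
    have hsr : s ∈ Metric.ball r ε := by
      rw [Metric.mem_ball, Real.dist_eq, abs_lt]
      constructor <;> linarith
    exact hball hsr hs

end LastPoint

/-! ### Measurability of right-continuous functions. -/

section Measurability

open MeasureTheory

/-- A right-continuous function on the line is strongly measurable. -/
lemma stronglyMeasurable_of_continuousWithinAt_Ici {E : Type*} [NormedAddCommGroup E]
    {g : ℝ → E} (hg : ∀ r, ContinuousWithinAt g (Ici r) r) : StronglyMeasurable g := by
  have hm : ∀ k : ℕ, StronglyMeasurable
      -- The grid point is the first one strictly to the right of `r`, so right continuity suffices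
      -- for convergence.
      fun r : ℝ => g ((⌊((k : ℝ) + 1) * r⌋ + 1 : ℝ) / ((k : ℝ) + 1)) := fun k => by
    have h1 : StronglyMeasurable fun z : ℤ => g ((z + 1 : ℝ) / ((k : ℝ) + 1)) :=
      StronglyMeasurable.of_discrete
    exact h1.comp_measurable (Int.measurable_floor.comp (measurable_const_mul _))
  refine stronglyMeasurable_of_tendsto atTop hm (tendsto_pi_nhds.2 fun r => ?_)
  refine (hg r).tendsto.comp (tendsto_nhdsWithin_iff.2 ⟨?_, ?_⟩)
  · have hlim : Tendsto (fun k : ℕ => r + 1 / ((k : ℝ) + 1)) atTop (𝓝 (r + 0)) :=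
      tendsto_one_div_add_atTop_nhds_zero_nat.const_add r
    rw [add_zero] at hlim
    refine tendsto_of_tendsto_of_tendsto_of_le_of_le tendsto_const_nhds hlim (fun k => ?_)
      fun k => ?_
    · have hk : (0 : ℝ) < (k : ℝ) + 1 := by positivity
      change r ≤ _
      rw [le_div_iff₀ hk]
      linarith [Int.lt_floor_add_one (((k : ℝ) + 1) * r)]
    · have hk : (0 : ℝ) < (k : ℝ) + 1 := by positivity
      change _ ≤ r + 1 / ((k : ℝ) + 1)
      rw [div_le_iff₀ hk, add_mul r, div_mul_cancel₀ _ hk.ne']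
      linarith [Int.floor_le (((k : ℝ) + 1) * r)]
  · refine Eventually.of_forall fun k => ?_
    have hk : (0 : ℝ) < (k : ℝ) + 1 := by positivity
    change r ≤ _
    rw [le_div_iff₀ hk]
    linarith [Int.lt_floor_add_one (((k : ℝ) + 1) * r)]

end Measurability

/-! ### The delta integral. -/

section DeltaIntegral

open MeasureTheory

variable {T : Set ℝ} {E : Type*} [NormedAddCommGroup E]

lemma RdContinuous.intervalIntegrable_of_le (hT : IsTimeScale T) (hu : ¬ BddAbove T) {f : ℝ → E}
    (hf : RdContinuous T f) {a b : ℝ} (ha : a ∈ T) (hab : a ≤ b) :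
    IntervalIntegrable (fun r => f (lastPoint T r)) volume a b := by
  obtain ⟨K, -, hK⟩ := hf.exists_norm_le hT hu a b
  have hm := stronglyMeasurable_of_continuousWithinAt_Ici
    (hf.continuousWithinAt_comp_lastPoint hT hu)
  rw [intervalIntegrable_iff_integrableOn_Ioc_of_le hab]
  refine Integrable.of_bound (C := K) (by exact hm.aestronglyMeasurable) ?_
  refine (ae_restrict_iff' measurableSet_Ioc).2 (Eventually.of_forall fun r hr => ?_)
  exact hK _ (lastPoint_mem hT ha hr.1.le) (le_lastPoint ha hr.1.le)
    ((lastPoint_le ha hr.1.le).trans hr.2)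

lemma RdContinuous.intervalIntegrable (hT : IsTimeScale T) (hu : ¬ BddAbove T) {f : ℝ → E}
    (hf : RdContinuous T f) {a b : ℝ} (ha : a ∈ T) (hb : b ∈ T) :
    IntervalIntegrable (fun r => f (lastPoint T r)) volume a b := by
  rcases le_total a b with h | h
  · exact hf.intervalIntegrable_of_le hT hu ha h
  · exact (hf.intervalIntegrable_of_le hT hu hb h).symm

variable [NormedSpace ℝ E]

/-- The delta integral of `f` over `[a, b)`, as the integral over the line of the extension of `f`
that is constant on the gaps of the time scale. -/
noncomputable def deltaIntegral (T : Set ℝ) (f : ℝ → E) (a b : ℝ) : E :=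
  ∫ r in a..b, f (lastPoint T r)

lemma deltaIntegral_self (f : ℝ → E) (a : ℝ) : deltaIntegral T f a a = 0 :=
  intervalIntegral.integral_same

/-- The delta integral of an rd-continuous function is an antiderivative. -/
theorem hasDeltaDeriv_deltaIntegral [CompleteSpace E] (hT : IsTimeScale T) (hu : ¬ BddAbove T)
    {f : ℝ → E} (hf : RdContinuous T f) {a t : ℝ} (ha : a ∈ T) (ht : t ∈ T) :
    HasDeltaDeriv T (deltaIntegral T f a) (f t) t := by
  have hint : ∀ {b c : ℝ}, b ∈ T → c ∈ T →
      IntervalIntegrable (fun r => f (lastPoint T r)) volume b c :=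
    fun hb hc => hf.intervalIntegrable hT hu hb hc
  have hσ := forwardJump_mem hT hu t
  have hdiff : ∀ s ∈ T, deltaIntegral T f a (forwardJump T t) - deltaIntegral T f a s
      - (forwardJump T t - s) • f t = ∫ r in s..forwardJump T t, (f (lastPoint T r) - f t) := by
    intro s hs
    rw [intervalIntegral.integral_sub (hint hs hσ) intervalIntegrable_const,
      intervalIntegral.integral_const]
    simp only [deltaIntegral]
    rw [intervalIntegral.integral_interval_sub_left (hint ha hσ) (hint ha hs)]
  intro ε hε
  rcases (le_forwardJump hu t).eq_or_lt with hd | hd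
  · have hc := (hf t ht).1 hd.symm
    have hev : ∀ᶠ s in 𝓝[T] t, ‖f s - f t‖ < ε := by
      have := hc.eventually (Metric.ball_mem_nhds (f t) hε)
      simpa [Metric.mem_ball, dist_eq_norm] using this
    rw [eventually_nhdsWithin_iff, Metric.eventually_nhds_iff] at hev
    obtain ⟨δ, hδ, H⟩ := hev
    filter_upwards [eventually_mem_nhdsWithin,
      mem_nhdsWithin_of_mem_nhds (Metric.ball_mem_nhds t hδ)] with s hs hsδ
    rw [hdiff s hs, ← hd]
    refine intervalIntegral.norm_integral_le_of_norm_le_const fun r hr => ?_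
    rw [Metric.mem_ball, Real.dist_eq, abs_lt] at hsδ
    have hmin : min s t ∈ T := by rcases min_choice s t with h | h <;> rw [h] <;> assumption
    have h1 : min s t ≤ lastPoint T r := le_lastPoint hmin hr.1.le
    have h2 : lastPoint T r ≤ max s t := (lastPoint_le hmin hr.1.le).trans hr.2
    refine (H ?_ (lastPoint_mem hT hmin hr.1.le)).le
    rw [Real.dist_eq, abs_lt]
    constructor
    · rcases min_choice s t with h | h <;> rw [h] at h1 <;> linarith
    · rcases max_choice s t with h | h <;> rw [h] at h2 <;> linarith
  -- At a right-scattered point the integrand vanishes on the gap after `t`. The part over `[s, t]`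
  -- is at most `2 K (t - s)`, and `σ t - s ≥ μ > 0` makes this at most `ε (σ t - s)` for `s` near
  -- `t`.
  · obtain ⟨K, h0, hK⟩ := hf.exists_norm_le hT hu (t - 1) t
    set μ := forwardJump T t - t with hμ
    have hμ0 : 0 < μ := sub_pos.2 hd
    have hb : 0 < ε * μ / (2 * (K + 1)) := by positivity
    filter_upwards [eventually_mem_nhdsWithin, eventually_le_of_lt_forwardJump hd,
      (eventually_gt_nhds (sub_lt_self t one_pos)).filter_mono nhdsWithin_le_nhds,
      (eventually_gt_nhds (sub_lt_self t hb)).filter_mono nhdsWithin_le_nhds] with s hs hst h1 h2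
    rw [hdiff s hs, ← intervalIntegral.integral_add_adjacent_intervals (b := t)
      ((hint hs ht).sub intervalIntegrable_const) ((hint ht hσ).sub intervalIntegrable_const)]
    have hzero : ∫ r in t..forwardJump T t, (f (lastPoint T r) - f t) = 0 := by
      rw [intervalIntegral.integral_congr_Ioo_of_le hd.le (g := fun _ => 0)]
      · simp
      · intro r hr
        change f (lastPoint T r) - f t = 0
        rw [lastPoint_eq_of_lt_forwardJump ht hr.1.le hr.2, sub_self]
    rw [hzero, add_zero]
    have hle : ‖∫ r in s..t, (f (lastPoint T r) - f t)‖ ≤ 2 * K * |t - s| := by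
      refine intervalIntegral.norm_integral_le_of_norm_le_const fun r hr => ?_
      rw [uIoc_of_le hst] at hr
      have hl : ‖f (lastPoint T r)‖ ≤ K := hK _ (lastPoint_mem hT hs hr.1.le)
        (h1.le.trans (le_lastPoint hs hr.1.le)) ((lastPoint_le hs hr.1.le).trans hr.2)
      have hft : ‖f t‖ ≤ K := hK t ht (by linarith) le_rfl
      exact (norm_sub_le _ _).trans (by linarith)
    refine hle.trans ?_
    rw [abs_of_nonneg (sub_nonneg.2 hst), abs_of_nonneg (by linarith)]
    have h3 : (t - s) * (2 * (K + 1)) ≤ ε * μ := by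
      rw [← le_div_iff₀ (by positivity)]
      linarith
    have h4 : ε * μ ≤ ε * (forwardJump T t - s) := mul_le_mul_of_nonneg_left (by linarith) hε.le
    nlinarith

lemma deltaIntegral_add {f g : ℝ → E} (hT : IsTimeScale T) (hu : ¬ BddAbove T)
    (hf : RdContinuous T f) (hg : RdContinuous T g) {a b : ℝ} (ha : a ∈ T) (hb : b ∈ T) :
    deltaIntegral T (fun t => f t + g t) a b = deltaIntegral T f a b + deltaIntegral T g a b :=
  intervalIntegral.integral_add (hf.intervalIntegrable hT hu ha hb)
    (hg.intervalIntegrable hT hu ha hb)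

lemma deltaIntegral_smul (c : ℝ) (f : ℝ → E) (a b : ℝ) :
    deltaIntegral T (fun t => c • f t) a b = c • deltaIntegral T f a b :=
  intervalIntegral.integral_smul _ _

lemma ContinuousLinearMap.map_deltaIntegral [CompleteSpace E] {F : Type*} [NormedAddCommGroup F]
    [NormedSpace ℝ F] [CompleteSpace F] (L : E →L[ℝ] F) {f : ℝ → E} (hT : IsTimeScale T)
    (hu : ¬ BddAbove T) (hf : RdContinuous T f) {a b : ℝ} (ha : a ∈ T) (hb : b ∈ T) :
    L (deltaIntegral T f a b) = deltaIntegral T (fun t => L (f t)) a b :=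
  (L.intervalIntegral_comp_comm (hf.intervalIntegrable hT hu ha hb)).symm

lemma deltaIntegral_eq_zero {f : ℝ → E} (hT : IsTimeScale T) {a b : ℝ} (ha : a ∈ T)
    (hab : a ≤ b) (h : ∀ t ∈ T, a ≤ t → t < b → f t = 0) : deltaIntegral T f a b = 0 := by
  rw [deltaIntegral, intervalIntegral.integral_congr_Ioo_of_le hab (g := fun _ => 0)]
  · simp
  · intro r hr
    exact h _ (lastPoint_mem hT ha hr.1.le) (le_lastPoint ha hr.1.le)
      ((lastPoint_le ha hr.1.le).trans_lt hr.2)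

/-- A nonnegative rd-continuous function with vanishing delta integral vanishes. -/
lemma eq_zero_of_deltaIntegral_eq_zero (hT : IsTimeScale T) (hu : ¬ BddAbove T) {f : ℝ → ℝ}
    (hf : RdContinuous T f) {a b : ℝ} (ha : a ∈ T) (hb : b ∈ T) (h0 : ∀ t, 0 ≤ f t)
    (hz : deltaIntegral T f a b = 0) : ∀ t ∈ T, a ≤ t → t < b → f t = 0 := by
  intro t ht hat htb
  by_contra hne
  have hpos : 0 < f t := lt_of_le_of_ne (h0 t) (Ne.symm hne)
  have hc := hf.continuousWithinAt_comp_lastPoint hT hu t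
  have hev : ∀ᶠ r in 𝓝[Ici t] t, f t / 2 < f (lastPoint T r) := by
    refine hc.eventually (lt_mem_nhds ?_)
    simp only [lastPoint_of_mem ht]
    linarith
  -- Right continuity of the extension keeps it above `f t / 2` on an interval of positive length,
  -- even if `t` is isolated in `T`.
  obtain ⟨c, htc, hc⟩ := mem_nhdsGE_iff_exists_Ico_subset.1 hev
  have htc : t < c := htc
  set d := min c b with hd
  have htd : t < d := lt_min htc htb
  have hint := hf.intervalIntegrable hT hu ha hb
  have h1 : (d - t) * (f t / 2) ≤ ∫ r in t..d, f (lastPoint T r) := by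
    have : ∫ r in t..d, f t / 2 ≤ ∫ r in t..d, f (lastPoint T r) := by
      refine intervalIntegral.integral_mono_on_of_le_Ioo htd.le intervalIntegrable_const
        (hf.intervalIntegrable_of_le hT hu ht htd.le) fun r hr => ?_
      exact le_of_lt (hc ⟨hr.1.le, hr.2.trans_le (min_le_left _ _)⟩)
    rwa [intervalIntegral.integral_const, smul_eq_mul] at this
  have h2 : ∫ r in t..d, f (lastPoint T r) ≤ ∫ r in a..b, f (lastPoint T r) :=
    intervalIntegral.integral_mono_interval hat htd.le (min_le_right _ _)
      (Eventually.of_forall fun r => h0 _) hint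
  rw [deltaIntegral] at hz
  nlinarith [mul_pos (sub_pos.2 htd) (half_pos hpos)]

end DeltaIntegral

/-! ### Controllability and observability in the coordinates `z`. -/

namespace RegressiveSystem

section StateSpace

variable {T : Set ℝ} {n m p : ℕ} (S : RegressiveSystem T n m p)
  {Φ : ℝ → ℝ → Matrix (Fin n) (Fin n) ℝ}

/-- The input matrix after the change of variables `x(t) = Φ(t, τ) z(t)`. -/
noncomputable def transformedInput (Φ : ℝ → ℝ → Matrix (Fin n) (Fin n) ℝ) (τ s : ℝ) :
    Matrix (Fin n) (Fin m) ℝ := Φ τ (forwardJump T s) * S.B s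

/-- The output matrix after the change of variables `x(t) = Φ(t, τ) z(t)`. -/
noncomputable def transformedOutput (Φ : ℝ → ℝ → Matrix (Fin n) (Fin n) ℝ) (τ t : ℝ) :
    Matrix (Fin p) (Fin n) ℝ := S.C t * Φ t τ

variable (hT : IsTimeScale T) (hu : ¬ BddAbove T) (hΦ : IsTransitionMatrix T S.A Φ)
include hT hu hΦ

lemma rdContinuous_transformedInput {τ : ℝ} (hτ : τ ∈ T) :
    RdContinuous T (S.transformedInput Φ τ) :=
  ((hΦ.continuousOn_right hT hu S.rdContinuous_A S.regressive hτ).rdContinuous_comp_forwardJump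
    hT hu).comp₂ S.rdContinuous_B (h := fun X Y => X * Y) (continuous_fst.matrix_mul continuous_snd)

omit hT hu in
lemma rdContinuous_transformedOutput {τ : ℝ} (hτ : τ ∈ T) :
    RdContinuous T (S.transformedOutput Φ τ) :=
  S.rdContinuous_C.comp₂ (rdContinuous_of_continuousOn (hΦ.continuousOn_left hτ))
    (h := fun X Y => X * Y) (continuous_fst.matrix_mul continuous_snd)

lemma transition_mul {t τ s : ℝ} (ht : t ∈ T) (hτ : τ ∈ T) (hs : s ∈ T) :
    Φ t τ * Φ τ s = Φ t s :=
  hΦ.mul hT hu S.rdContinuous_A S.regressive ht hτ hs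

lemma transition_mulVec_cancel {t τ : ℝ} (ht : t ∈ T) (hτ : τ ∈ T) (v : Fin n → ℝ) :
    Φ t τ *ᵥ (Φ τ t *ᵥ v) = v := by
  rw [mulVec_mulVec, S.transition_mul hT hu hΦ ht hτ ht, (hΦ t ht).1, one_mulVec]

lemma transformedOutput_mul_transformedInput {τ t s : ℝ} (hτ : τ ∈ T) (ht : t ∈ T) :
    S.transformedOutput Φ τ t * S.transformedInput Φ τ s
      = S.C t * Φ t (forwardJump T s) * S.B s := by
  rw [← S.transition_mul hT hu hΦ ht hτ (forwardJump_mem hT hu s)]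
  simp only [transformedOutput, transformedInput, Matrix.mul_assoc]

lemma rdContinuous_transformedInput_mulVec {τ : ℝ} (hτ : τ ∈ T) {u : ℝ → Fin m → ℝ}
    (hrd : RdContinuous T u) : RdContinuous T fun s => S.transformedInput Φ τ s *ᵥ u s :=
  (S.rdContinuous_transformedInput hT hu hΦ hτ).comp₂ hrd (h := fun X v => X *ᵥ v)
    (continuous_fst.matrix_mulVec continuous_snd)

/-- The variation of constants formula. -/
lemma isSolution_variation_of_constants {τ t₀ : ℝ} (hτ : τ ∈ T) (ht₀ : t₀ ∈ T)
    {u : ℝ → Fin m → ℝ} (hrd : RdContinuous T u) (z : Fin n → ℝ) :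
    S.IsSolution u fun t =>
      Φ t τ *ᵥ (z + deltaIntegral T (fun s => S.transformedInput Φ τ s *ᵥ u s) t₀ t) := by
  intro t ht
  have h1 := hasDeltaDeriv_deltaIntegral hT hu
    (S.rdContinuous_transformedInput_mulVec hT hu hΦ hτ hrd) ht₀ ht
  have h2 := hΦ.hasDeltaDeriv_mulVec hτ ht ((hasDeltaDeriv_const z t).add h1)
  -- The product rule produces `Φ(σ t, τ)`, which cancels the factor `Φ(τ, σ t)` of
  -- `transformedInput` and leaves `B u`.
  rw [zero_add, transformedInput, ← mulVec_mulVec,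
    S.transition_mulVec_cancel hT hu hΦ (forwardJump_mem hT hu t) hτ] at h2
  exact h2

omit hΦ in
lemma IsSolution.unique {u : ℝ → Fin m → ℝ} {x x' : ℝ → Fin n → ℝ} (hx : S.IsSolution u x)
    (hx' : S.IsSolution u x') {t₀ : ℝ} (ht₀ : t₀ ∈ T) (h : x t₀ = x' t₀) :
    ∀ t ∈ T, x t = x' t := by
  have hd : ∀ t ∈ T, HasDeltaDeriv T (fun t => x t - x' t) (S.A t *ᵥ (x t - x' t)) t :=
    fun t ht => by
      have := (hx t ht).sub (hx' t ht)
      rwa [add_sub_add_right_eq_sub, ← mulVec_sub] at this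
  exact fun t ht => sub_eq_zero.1 (solution_eq_zero hT hu S.rdContinuous_A S.regressive hd ht₀
    (sub_eq_zero.2 h) t ht)

lemma isControllable_iff {τ t₀ tf : ℝ} (hτ : τ ∈ T) (ht₀ : t₀ ∈ T) (htf : tf ∈ T)
    (hle : t₀ ≤ tf) :
    S.IsControllable t₀ tf ↔ ∀ v : Fin n → ℝ,
      (∀ s ∈ T, t₀ ≤ s → s < tf → v ᵥ* S.transformedInput Φ τ s = 0) → v = 0 := by
  have hdot : ∀ (v : Fin n → ℝ) {f : ℝ → Fin n → ℝ}, RdContinuous T f →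
      v ⬝ᵥ deltaIntegral T f t₀ tf = deltaIntegral T (fun s => v ⬝ᵥ f s) t₀ tf := fun v f hf =>
    (LinearMap.toContinuousLinearMap (dotProductBilin ℝ ℝ v)).map_deltaIntegral hT hu hf ht₀ htf
  constructor
  · intro hc v hv
    -- The target is `z = v`. Steering there from `0` makes `v ⬝ᵥ v` an integral of zeros.
    obtain ⟨u, hrd, x, hx, hx0, hxf⟩ := hc 0 (Φ tf τ *ᵥ v)
    have hB := S.rdContinuous_transformedInput_mulVec hT hu hΦ hτ hrd
    have h1 := IsSolution.unique S hT hu hx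
      (S.isSolution_variation_of_constants hT hu hΦ hτ ht₀ hrd 0) ht₀
      (by rw [deltaIntegral_self, add_zero, mulVec_zero, hx0]) tf htf
    rw [hxf, zero_add] at h1
    have h2 := congrArg (fun w => Φ τ tf *ᵥ w) h1
    simp only [S.transition_mulVec_cancel hT hu hΦ hτ htf] at h2
    have h3 : v ⬝ᵥ v = 0 := by
      refine (congrArg (v ⬝ᵥ ·) h2).trans ((hdot v hB).trans ?_)
      refine deltaIntegral_eq_zero hT ht₀ hle fun s hs h4 h5 => ?_
      rw [dotProduct_mulVec, hv s hs h4 h5, zero_dotProduct]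
    exact dotProduct_self_eq_zero.1 h3
  · intro hv
    have hrd : ∀ v : Fin n → ℝ, RdContinuous T fun s => v ᵥ* S.transformedInput Φ τ s := fun v =>
      (S.rdContinuous_transformedInput hT hu hΦ hτ).comp (h := fun X => v ᵥ* X)
        (continuous_const.matrix_vecMul continuous_id)
    have hB := fun v => S.rdContinuous_transformedInput_mulVec hT hu hΦ hτ (hrd v)
    -- The controllability Gramian `∫ β βᵀ`. Since `v ⬝ᵥ W v = ∫ |βᵀ v|²`, it is injective, hence
    -- onto, and the input `βᵀ v` moves `z` by `W v`.
    let W : (Fin n → ℝ) →ₗ[ℝ] (Fin n → ℝ) :=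
      { toFun := fun v => deltaIntegral T
          (fun s => S.transformedInput Φ τ s *ᵥ (v ᵥ* S.transformedInput Φ τ s)) t₀ tf
        map_add' := fun v w => by
          rw [← deltaIntegral_add hT hu (hB v) (hB w) ht₀ htf]
          simp only [add_vecMul, mulVec_add]
        map_smul' := fun c v => by
          rw [RingHom.id_apply, ← deltaIntegral_smul]
          simp only [smul_vecMul, mulVec_smul] }
    have hinj : Function.Injective W := by
      refine (injective_iff_map_eq_zero W).2 fun v hz => hv v fun s hs h1 h2 => ?_
      have h3 : deltaIntegral T (fun s => v ⬝ᵥ (S.transformedInput Φ τ s *ᵥ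
          (v ᵥ* S.transformedInput Φ τ s))) t₀ tf = 0 := by
        rw [← hdot v (hB v)]
        exact (congrArg (v ⬝ᵥ ·) hz).trans (dotProduct_zero v)
      simp only [dotProduct_mulVec] at h3
      have h4 : RdContinuous T fun s =>
          (v ᵥ* S.transformedInput Φ τ s) ⬝ᵥ (v ᵥ* S.transformedInput Φ τ s) :=
        (hrd v).comp (h := fun w => w ⬝ᵥ w) (continuous_id.dotProduct continuous_id)
      exact dotProduct_self_eq_zero.1 (eq_zero_of_deltaIntegral_eq_zero hT hu h4 ht₀ htf
        (fun t => Finset.sum_nonneg fun i _ => mul_self_nonneg _) h3 s hs h1 h2)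
    intro x₀ xf
    obtain ⟨v, hv⟩ := LinearMap.injective_iff_surjective.1 hinj (Φ τ tf *ᵥ xf - Φ τ t₀ *ᵥ x₀)
    refine ⟨_, hrd v, _, S.isSolution_variation_of_constants hT hu hΦ hτ ht₀ (hrd v)
      (Φ τ t₀ *ᵥ x₀), ?_, ?_⟩
    · rw [deltaIntegral_self, add_zero, S.transition_mulVec_cancel hT hu hΦ ht₀ hτ]
    · have hv' : deltaIntegral T
          (fun s => S.transformedInput Φ τ s *ᵥ (v ᵥ* S.transformedInput Φ τ s)) t₀ tf =
          Φ τ tf *ᵥ xf - Φ τ t₀ *ᵥ x₀ := hv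
      rw [hv', add_sub_cancel, S.transition_mulVec_cancel hT hu hΦ htf hτ]

/-- By uniqueness the zero-input solutions are exactly the `Φ(t, τ) v`, with response `γ(t) v`. -/
lemma isObservable_iff {τ t₀ tf : ℝ} (hτ : τ ∈ T) (ht₀ : t₀ ∈ T) :
    S.IsObservable t₀ tf ↔ ∀ v : Fin n → ℝ,
      (∀ t ∈ T, t₀ ≤ t → t < tf → S.transformedOutput Φ τ t *ᵥ v = 0) → v = 0 := by
  have hsol : ∀ v, S.IsSolution 0 fun t => Φ t τ *ᵥ v := fun v t ht => by
    have := hΦ.hasDeltaDeriv_mulVec_const hτ ht v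
    rwa [Pi.zero_apply, mulVec_zero, add_zero]
  constructor
  · intro ho v hv
    have h1 := ho _ _ (hsol v) (hsol 0) fun t ht h2 h3 => by
      rw [mulVec_mulVec, mulVec_zero, mulVec_zero]
      exact hv t ht h2 h3
    have h2 := congrArg (fun w => Φ τ t₀ *ᵥ w) h1
    simpa only [S.transition_mulVec_cancel hT hu hΦ hτ ht₀] using h2
  · intro hv x x' hx hx' hy
    have hform : ∀ {x}, S.IsSolution 0 x → ∀ t ∈ T, x t = Φ t τ *ᵥ (Φ τ t₀ *ᵥ x t₀) := fun hx =>
      IsSolution.unique S hT hu hx (hsol _) ht₀ (S.transition_mulVec_cancel hT hu hΦ ht₀ hτ _).symm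
    have h1 : Φ τ t₀ *ᵥ (x t₀ - x' t₀) = 0 := by
      refine hv _ fun t ht h2 h3 => ?_
      rw [transformedOutput, ← mulVec_mulVec, mulVec_sub, mulVec_sub, ← hform hx t ht,
        ← hform hx' t ht, mulVec_sub, hy t ht h2 h3, sub_self]
    have h2 := congrArg (fun w => Φ t₀ τ *ᵥ w) h1
    simp only [S.transition_mulVec_cancel hT hu hΦ ht₀ hτ, mulVec_zero] at h2
    exact sub_eq_zero.1 h2

end StateSpace

end RegressiveSystem

/-! ### Linear algebra of separated kernels. -/

section LinearAlgebra

/-- A proper subspace of `ℝⁿ` factors through a space of smaller dimension. -/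
lemma Submodule.exists_matrix_factor {n : ℕ} {W : Submodule ℝ (Fin n → ℝ)} (hW : W ≠ ⊤) :
    ∃ k < n, ∃ (Q : Matrix (Fin n) (Fin k) ℝ) (P : Matrix (Fin k) (Fin n) ℝ),
      ∀ w ∈ W, Q *ᵥ (P *ᵥ w) = w := by
  have hlt : Module.finrank ℝ W < n := by
    simpa using Submodule.finrank_lt (lt_top_iff_ne_top.2 hW).ne
  -- `g` projects onto `W`; `P` takes coordinates of the projection and `Q` maps coordinates back.
  obtain ⟨g, hg⟩ := W.subtype.exists_leftInverse_of_injective W.ker_subtype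
  let e := (Module.finBasis ℝ W).equivFun
  refine ⟨_, hlt, LinearMap.toMatrix' (W.subtype ∘ₗ e.symm.toLinearMap),
    LinearMap.toMatrix' (e.toLinearMap ∘ₗ g), fun w hw => ?_⟩
  rw [LinearMap.toMatrix'_mulVec, LinearMap.toMatrix'_mulVec]
  have h1 : g w = ⟨w, hw⟩ := LinearMap.congr_fun hg ⟨w, hw⟩
  simp [h1]

/-- If `v ≠ 0` annihilates all columns of the matrices `X`, these factor through a space of
smaller dimension. -/
lemma exists_matrix_factor_of_vecMul_eq_zero {n : ℕ} {v : Fin n → ℝ} (hv : v ≠ 0) :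
    ∃ k < n, ∃ (Q : Matrix (Fin n) (Fin k) ℝ) (P : Matrix (Fin k) (Fin n) ℝ),
      ∀ (m : ℕ) (X : Matrix (Fin n) (Fin m) ℝ), v ᵥ* X = 0 → Q * (P * X) = X := by
  have hW : LinearMap.ker (dotProductBilin ℝ ℝ v) ≠ ⊤ := fun h => by
    have h1 : v ∈ LinearMap.ker (dotProductBilin ℝ ℝ v) := h ▸ Submodule.mem_top
    exact hv (dotProduct_self_eq_zero.1 h1)
  obtain ⟨k, hk, Q, P, hQP⟩ := Submodule.exists_matrix_factor hW
  refine ⟨k, hk, Q, P, fun m X hX => ext_of_mulVec_single fun j => ?_⟩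
  rw [← mulVec_mulVec, ← mulVec_mulVec]
  refine hQP _ ?_
  change v ⬝ᵥ (X *ᵥ _) = 0
  rw [dotProduct_mulVec, hX, zero_dotProduct]

/-- The inner dimension of a factorization `γ t * β s` with injective `γ` and surjective `β` is
least possible. -/
lemma le_of_mul_eq_mul {ι : Type*} {n k m p : ℕ} {γ : ι → Matrix (Fin p) (Fin n) ℝ}
    {β : ι → Matrix (Fin n) (Fin m) ℝ} {γ' : ι → Matrix (Fin p) (Fin k) ℝ}
    {β' : ι → Matrix (Fin k) (Fin m) ℝ} (hγ : ∀ v, (∀ t, γ t *ᵥ v = 0) → v = 0)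
    (hβ : ∀ v, (∀ s, v ᵥ* β s = 0) → v = 0) (h : ∀ t s, γ t * β s = γ' t * β' s) : n ≤ k := by
  let c : (Fin n → ℝ) →ₗ[ℝ] (ι → Fin p → ℝ) := LinearMap.pi fun t => (γ t).mulVecLin
  let c' : (Fin k → ℝ) →ₗ[ℝ] (ι → Fin p → ℝ) := LinearMap.pi fun t => (γ' t).mulVecLin
  have hc : Function.Injective c := (injective_iff_map_eq_zero c).2 fun v hv =>
    hγ v fun t => congrFun hv t
  have hspan : ⨆ s, LinearMap.range (β s).mulVecLin = ⊤ := by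
    by_contra hne
    obtain ⟨f, hf, hle⟩ := Submodule.exists_le_ker_of_lt_top _ (lt_top_iff_ne_top.2 hne)
    have hfv : ∀ w, f w = (fun i => f (Pi.single i 1)) ⬝ᵥ w := fun w => by
      conv_lhs => rw [← Finset.univ_sum_single w, map_sum]
      refine Finset.sum_congr rfl fun i _ => ?_
      rw [mul_comm, ← smul_eq_mul, ← map_smul, ← Pi.single_smul, smul_eq_mul, mul_one]
    have h0 := hβ (fun i => f (Pi.single i 1)) fun s => by
      refine dotProduct_eq_zero _ fun w => ?_
      rw [← dotProduct_mulVec, ← hfv]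
      exact hle (Submodule.mem_iSup_of_mem s ⟨w, rfl⟩)
    exact hf (LinearMap.ext fun w => by rw [hfv, h0, zero_dotProduct, LinearMap.zero_apply])
  -- The vectors `β s w` span, and `c (β s w) = c' (β' s w)`. The target may be
  -- infinite-dimensional, but both ranges are finite-dimensional.
  have hrange : LinearMap.range c ≤ LinearMap.range c' := by
    rw [LinearMap.range_eq_map, ← hspan, Submodule.map_iSup]
    refine iSup_le fun s => ?_
    rintro _ ⟨_, ⟨w, rfl⟩, rfl⟩
    refine ⟨β' s *ᵥ w, funext fun t => ?_⟩
    change γ' t *ᵥ (β' s *ᵥ w) = γ t *ᵥ (β s *ᵥ w)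
    rw [mulVec_mulVec, mulVec_mulVec, h]
  calc n = Module.finrank ℝ (LinearMap.range c) := by
        rw [LinearMap.finrank_range_of_inj hc, Module.finrank_fin_fun]
    _ ≤ Module.finrank ℝ (LinearMap.range c') := Submodule.finrank_mono hrange
    _ ≤ Module.finrank ℝ (Fin k → ℝ) := LinearMap.finrank_range_le c'
    _ = k := Module.finrank_fin_fun ℝ

/-- In finite dimension, a trivial intersection of subspaces indexed by a set of reals is already
attained on a bounded part of the set. -/
lemma exists_bounded_of_iInf_eq_bot {V : Type*} [AddCommGroup V] [Module ℝ V]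
    [FiniteDimensional ℝ V] (T : Set ℝ) (M : ℝ → Submodule ℝ V)
    (h : ∀ v, (∀ t ∈ T, v ∈ M t) → v = 0) :
    ∃ N : ℕ, ∀ v, (∀ t ∈ T, |t| ≤ N → v ∈ M t) → v = 0 := by
  -- The intersections over `|t| ≤ N` decrease with `N`, so they stabilize.
  let F : ℕ →o (Submodule ℝ V)ᵒᵈ :=
    { toFun := fun N => OrderDual.toDual (⨅ t ∈ T, ⨅ _ : |t| ≤ N, M t)
      monotone' := fun N L hNL => OrderDual.toDual_le_toDual.2 <|
        le_iInf₂ fun t ht => le_iInf fun h1 =>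
          (iInf₂_le t ht).trans (iInf_le _ (h1.trans (by exact_mod_cast hNL))) }
  have hF : ∀ N v, v ∈ OrderDual.ofDual (F N) ↔ ∀ t ∈ T, |t| ≤ N → v ∈ M t := fun N v => by
    change v ∈ (⨅ t ∈ T, ⨅ _ : |t| ≤ (N : ℝ), M t) ↔ _
    simp only [Submodule.mem_iInf]
  obtain ⟨N, hN⟩ := IsArtinian.monotone_stabilizes F
  refine ⟨N, fun v hv => h v fun t ht => ?_⟩
  obtain ⟨L, hL⟩ := exists_nat_ge |t|
  have h1 : v ∈ OrderDual.ofDual (F (max N L)) := by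
    rw [← hN _ (le_max_left N L)]
    exact (hF N v).2 hv
  exact (hF _ v).1 h1 t ht (hL.trans (by exact_mod_cast le_max_right N L))

end LinearAlgebra

/-- An interval of the time scale that contains all its points of modulus at most `N`. -/
lemma IsTimeScale.exists_interval {T : Set ℝ} (hT : IsTimeScale T) (hu : ¬ BddAbove T) (N : ℝ) :
    ∃ t₀ ∈ T, ∃ tf ∈ T, t₀ < tf ∧ ∀ t ∈ T, |t| ≤ N → t₀ ≤ t ∧ t < tf := by
  obtain ⟨t₀, ht₀, h0⟩ : ∃ t₀ ∈ T, ∀ t ∈ T, -N ≤ t → t₀ ≤ t := by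
    -- If no point lies at or below `-N`, then `T` has a least element, which serves as left end.
    by_cases h : ∃ t ∈ T, t ≤ -N
    · obtain ⟨t₀, ht₀, h0⟩ := h
      exact ⟨t₀, ht₀, fun t _ h1 => h0.trans h1⟩
    · push Not at h
      have hb : BddBelow T := ⟨-N, fun t ht => (h t ht).le⟩
      exact ⟨sInf T, hT.isClosed.csInf_mem hT.nonempty hb, fun t ht _ => csInf_le hb ht⟩
  obtain ⟨tf, htf, hf⟩ := exists_mem_gt hu (max N t₀)
  exact ⟨t₀, ht₀, tf, htf, (le_max_right _ _).trans_lt hf, fun t ht hN =>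
    ⟨h0 t ht (abs_le.1 hN).1, (abs_le.1 hN).2.trans_lt ((le_max_left _ _).trans_lt hf)⟩⟩

/-! ### Minimality. -/

namespace RegressiveSystem

variable {T : Set ℝ} {n m p : ℕ}

/-- A separated kernel with rd-continuous factors is realized by a system with `A = 0`. -/
lemma exists_isRealization_of_factorization {k : ℕ} {γ : ℝ → Matrix (Fin p) (Fin k) ℝ}
    {β : ℝ → Matrix (Fin k) (Fin m) ℝ} (hγ : RdContinuous T γ) (hβ : RdContinuous T β)
    {G : ℝ → ℝ → Matrix (Fin p) (Fin m) ℝ} (hG : ∀ t ∈ T, ∀ s ∈ T, G t s = γ t * β s) :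
    ∃ S : RegressiveSystem T k m p, S.IsRealization G := by
  refine ⟨⟨fun _ => 0, β, γ, rdContinuous_of_continuousOn continuousOn_const, hβ, hγ,
    fun t _ => by simp⟩, fun _ _ => 1, fun τ _ => ⟨rfl, fun t _ i j => ?_⟩, fun t ht s hs => ?_⟩
  · simpa using hasDeltaDeriv_const (T := T) ((1 : Matrix (Fin k) (Fin k) ℝ) i j) t
  · rw [hG t ht s hs, Matrix.mul_one]

section Minimality

variable (S : RegressiveSystem T n m p) {Φ : ℝ → ℝ → Matrix (Fin n) (Fin n) ℝ}
  {G : ℝ → ℝ → Matrix (Fin p) (Fin m) ℝ} (hT : IsTimeScale T) (hu : ¬ BddAbove T)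
  (hΦ : IsTransitionMatrix T S.A Φ)
  (hG : ∀ t ∈ T, ∀ s ∈ T, G t s = S.C t * Φ t (forwardJump T s) * S.B s)
include hT hu hΦ hG

lemma weightingPattern_eq {τ t s : ℝ} (hτ : τ ∈ T) (ht : t ∈ T) (hs : s ∈ T) :
    G t s = S.transformedOutput Φ τ t * S.transformedInput Φ τ s := by
  rw [hG t ht s hs, S.transformedOutput_mul_transformedInput hT hu hΦ hτ ht]

lemma isMinimalRealization_of_controllable_of_observable {t₀ tf : ℝ} (ht₀ : t₀ ∈ T) (htf : tf ∈ T)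
    (hle : t₀ ≤ tf) (hc : S.IsControllable t₀ tf) (ho : S.IsObservable t₀ tf) :
    S.IsMinimalRealization G := by
  refine ⟨⟨Φ, hΦ, hG⟩, ?_⟩
  rintro ⟨k, hk, S', Φ', hΦ', hG'⟩
  rw [S.isControllable_iff hT hu hΦ ht₀ ht₀ htf hle] at hc
  rw [S.isObservable_iff hT hu hΦ ht₀ ht₀] at ho
  refine absurd hk (not_lt.2 (le_of_mul_eq_mul (ι := T)
    (γ := fun t => S.transformedOutput Φ t₀ t) (β := fun s => S.transformedInput Φ t₀ s)
    (γ' := fun t => S'.transformedOutput Φ' t₀ t) (β' := fun s => S'.transformedInput Φ' t₀ s)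
    (fun v hv => ho v fun t ht _ _ => hv ⟨t, ht⟩) (fun v hv => hc v fun t ht _ _ => hv ⟨t, ht⟩)
    fun t s => ?_))
  rw [← S.weightingPattern_eq hT hu hΦ hG ht₀ t.2 s.2,
    S'.weightingPattern_eq hT hu hΦ' hG' ht₀ t.2 s.2]

lemma eq_zero_of_vecMul_transformedInput (hmin : S.IsMinimalRealization G) {τ : ℝ} (hτ : τ ∈ T)
    (v : Fin n → ℝ) (hv : ∀ s ∈ T, v ᵥ* S.transformedInput Φ τ s = 0) : v = 0 := by
  by_contra hne
  obtain ⟨k, hk, Q, P, hQP⟩ := exists_matrix_factor_of_vecMul_eq_zero hne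
  refine hmin.2 ⟨k, hk, exists_isRealization_of_factorization
    (γ := fun t => S.transformedOutput Φ τ t * Q) (β := fun s => P * S.transformedInput Φ τ s)
    ((S.rdContinuous_transformedOutput hΦ hτ).comp (h := fun X => X * Q)
      (continuous_id.matrix_mul continuous_const))
    ((S.rdContinuous_transformedInput hT hu hΦ hτ).comp (h := fun X => P * X)
      (continuous_const.matrix_mul continuous_id)) fun t ht s hs => ?_⟩
  rw [S.weightingPattern_eq hT hu hΦ hG hτ ht hs, Matrix.mul_assoc, hQP _ _ (hv s hs)]

/-- The dual case: the factorization through a smaller space is applied to the transpose of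
`transformedOutput`. -/
lemma eq_zero_of_transformedOutput_mulVec (hmin : S.IsMinimalRealization G) {τ : ℝ} (hτ : τ ∈ T)
    (v : Fin n → ℝ) (hv : ∀ t ∈ T, S.transformedOutput Φ τ t *ᵥ v = 0) : v = 0 := by
  by_contra hne
  obtain ⟨k, hk, Q, P, hQP⟩ := exists_matrix_factor_of_vecMul_eq_zero hne
  refine hmin.2 ⟨k, hk, exists_isRealization_of_factorization
    (γ := fun t => S.transformedOutput Φ τ t * Pᵀ) (β := fun s => Qᵀ * S.transformedInput Φ τ s)
    ((S.rdContinuous_transformedOutput hΦ hτ).comp (h := fun X => X * Pᵀ)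
      (continuous_id.matrix_mul continuous_const))
    ((S.rdContinuous_transformedInput hT hu hΦ hτ).comp (h := fun X => Qᵀ * X)
      (continuous_const.matrix_mul continuous_id)) fun t ht s hs => ?_⟩
  have h1 := congrArg transpose (hQP _ (S.transformedOutput Φ τ t)ᵀ
    (by rw [vecMul_transpose, hv t ht]))
  rw [transpose_mul, transpose_mul, transpose_transpose] at h1
  rw [S.weightingPattern_eq hT hu hΦ hG hτ ht hs, ← Matrix.mul_assoc, h1]

lemma IsMinimalRealization.exists_controllable_observable (hmin : S.IsMinimalRealization G) :
    ∃ t₀ ∈ T, ∃ tf ∈ T, t₀ < tf ∧ S.IsControllable t₀ tf ∧ S.IsObservable t₀ tf := by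
  obtain ⟨τ, hτ⟩ := hT.nonempty
  obtain ⟨N, hN⟩ := exists_bounded_of_iInf_eq_bot T
    (fun s => LinearMap.ker (S.transformedInput Φ τ s).vecMulLinear)
    fun v hv => S.eq_zero_of_vecMul_transformedInput hT hu hΦ hG hmin hτ v hv
  obtain ⟨L, hL⟩ := exists_bounded_of_iInf_eq_bot T
    (fun t => LinearMap.ker (S.transformedOutput Φ τ t).mulVecLin)
    fun v hv => S.eq_zero_of_transformedOutput_mulVec hT hu hΦ hG hmin hτ v hv
  obtain ⟨t₀, ht₀, tf, htf, hlt, hI⟩ := hT.exists_interval hu (max N L)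
  refine ⟨t₀, ht₀, tf, htf, hlt, ?_, ?_⟩
  · refine (S.isControllable_iff hT hu hΦ hτ ht₀ htf hlt.le).2 fun v hv => hN v fun s hs h => ?_
    have := hI s hs (h.trans (le_max_left _ _))
    exact hv s hs this.1 this.2
  · refine (S.isObservable_iff hT hu hΦ hτ ht₀).2 fun v hv => hL v fun t ht h => ?_
    have := hI t ht (h.trans (le_max_right _ _))
    exact hv t ht this.1 this.2

end Minimality

end RegressiveSystem

theorem theorem4p4 (T : Set ℝ) (hT : IsTimeScale T) (hunbounded : ¬ BddAbove T)
    (hgraininess : ∃ M : ℝ, ∀ t ∈ T, graininess T t ≤ M)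
    (n m p : ℕ) (S : RegressiveSystem T n m p)
    (G : ℝ → ℝ → Matrix (Fin p) (Fin m) ℝ) (hS : S.IsRealization G) :
    S.IsMinimalRealization G ↔
      ∃ t₀ ∈ T, ∃ tf ∈ T, t₀ < tf ∧ S.IsControllable t₀ tf ∧ S.IsObservable t₀ tf := by
  obtain ⟨Φ, hΦ, hG⟩ := hS
  constructor
  · exact RegressiveSystem.IsMinimalRealization.exists_controllable_observable S hT hunbounded hΦ hG
  · rintro ⟨t₀, ht₀, tf, htf, hlt, hc, ho⟩
    exact S.isMinimalRealization_of_controllable_of_observable hT hunbounded hΦ hG ht₀ htf hlt.le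
      hc ho
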